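/- Let $p$ be a prime, $q$ a power of $p$, and let $f,k$ be positive integers with $f\mid k$ and $k>f>1$. Consider finite fields $\mathbb F_q\subset\mathbb F_{q^f}\subset\mathbb F_{q^k}$; write $\mathrm{Tr}_{q^k/q}$, $\mathrm{Tr}_{q^f/q}$ for the trace maps to $\mathbb F_q$, and let $\chi_1(x)=e^{2\pi i\,\mathrm{Tr}_{q^f/p}(x)/p}$ be the canonical additive character of $\mathbb F_{q^f}$. For a multiplicative character $\psi$ of $\mathbb F_{q^f}$ let $G(\psi,\chi_1)=\sum_{x\in\mathbb F_{q^f}^*}\psi(x)\chi_1(x)$. Put $$D=\{x\in\mathbb F_{q^k}^*:\mathrm{Tr}_{q^f/q}(x^{(q^k-1)/(q^f-1)})=0\}$$ (here $x^{(q^k-1)/(q^f-1)}$ is the norm of $x$ to $\mathbb F_{q^f}$), let $\mathbf c_b=(\mathrm{Tr}_{q^k/q}(bd))_{d\in D}$ for $b\in\mathbb F_{q^k}$, and $\mathcal C_D=\{\mathbf c_b: b\in\mathbb F_{q^k}\}$. (i) For every multiplicative character $\varphi$ of $\mathbb F_{q^f}$ of order $\frac{q^f-1}{q-1}$ and every $b\in\mathbb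 F_{q^k}^*$, the Hamming weight of $\mathbf c_b$ is $$w(\mathbf c_b)=\frac{(q-1)q^{k-2}(q^f-q)}{q^f-1}-\frac{(-1)^{\frac kf-1}q^f(q-1)^2}{q^2(q^f-1)}\sum_{j=1}^{\frac{q^f-1}{q-1}-1}\varphi^j(-1)\,G(\varphi^j,\chi_1)^{\frac kf-1}\,\overline{\varphi}^{\,j}\bigl(b^{\frac{q^k-1}{q^f-1}}\bigr).$$ (ii) $\mathcal C_D$ is a linear code over $\mathbb F_q$ of length $\frac{(q^k-1)(q^f-q)}{q(q^f-1)}$, dimension $k$ and minimum Hamming distance $$d\ge\frac{(q-1)(q^f-q)\bigl(q^{k-2}-q^{\frac{k+f-4}{2}}\bigr)}{q^f-1}.$$ -/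

import Mathlib

/-- The length, dimension and minimum Hamming distance of a linear code
`C` over `F` whose coordinate positions are the elements of the finite type `ι`:
`C` is an `[n, l, d]` linear code. -/
structure IsLinearCode {F ι : Type*} [Field F] [DecidableEq F] [Fintype ι]
    (C : Submodule F (ι → F)) (n l d : ℕ) : Prop where
  length_eq : Fintype.card ι = n
  dim_eq : Module.finrank F C = l
  minDist : IsLeast {w : ℕ | ∃ x ∈ C, ∃ y ∈ C, x ≠ y ∧ hammingDist x y = w} d

section CodeDefinitions

variable (F K L : Type*) [Field F] [Field K] [Field L] [Algebra F K] [Algebra F L] [Algebra K L]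

/-- For finite fields, the norm of `x` from `L` to `K`, seen in `L`, is the power
`x ^ ((|L| - 1) / (|K| - 1))`. This is the sense in which that power lies in `K`. -/
theorem algebraMap_norm_eq_power [Fintype K] [Fintype L] (x : L) :
    algebraMap K L (Algebra.norm K x) = x ^ ((Fintype.card L - 1) / (Fintype.card K - 1)) := by
  rw [← Nat.card_eq_fintype_card, ← Nat.card_eq_fintype_card]
  exact FiniteField.algebraMap_norm_eq_pow

/-- The defining set: the nonzero `x : L` with `Tr_{K/F}(N_{L/K}(x)) = 0`, where
`N_{L/K}(x) = x ^ ((|L| - 1) / (|K| - 1))` by `algebraMap_norm_eq_power`. -/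
noncomputable def definingSet [Fintype L] [DecidableEq F] [DecidableEq L] : Finset L :=
  {x : L | x ≠ 0 ∧ Algebra.trace F K (Algebra.norm K x) = 0}

variable {L} in
/-- For any finite set `D` of elements of `L`, the codeword `(Tr_{L/F}(b d))_{d ∈ D}`,
as a linear function of `b`. -/
noncomputable def codeword (D : Finset L) : L →ₗ[F] (D → F) :=
  LinearMap.pi fun d => Algebra.trace F L ∘ₗ LinearMap.mulRight F (d : L)

variable {L} in
theorem codeword_apply (D : Finset L) (b : L) (d : D) :
    codeword F D b d = Algebra.trace F L (b * d) := rfl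

variable {L} in
/-- The linear code `C_D = {c_b : b ∈ L}` with defining set `D`. -/
noncomputable def linearCode (D : Finset L) : Submodule F (D → F) :=
  LinearMap.range (codeword F D)

end CodeDefinitions

/-- The canonical additive character `x ↦ exp (2 π i Tr(x) / p)` of a finite field `K`
of characteristic `p`, where `Tr` is the absolute trace from `K` to the prime field. -/
noncomputable def canonicalAddChar (p : ℕ) [Fact p.Prime] (K : Type*) [Field K]
    [Algebra (ZMod p) K] : AddChar K ℂ :=
  (ZMod.stdAddChar (N := p)).compAddMonoidHom (Algebra.trace (ZMod p) K).toAddMonoidHom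

theorem canonicalAddChar_apply (p : ℕ) [Fact p.Prime] (K : Type*) [Field K]
    [Algebra (ZMod p) K] (x : K) :
    canonicalAddChar p K x =
      Complex.exp (2 * Real.pi * Complex.I * ((Algebra.trace (ZMod p) K x).val : ℂ) / p) := by
  change ZMod.stdAddChar (Algebra.trace (ZMod p) K x) = _
  rw [ZMod.stdAddChar_apply, ZMod.toCircle_apply]

/-!
Write `Q = |K| = q ^ f`, `m = [L : K]`, `N = (Q - 1) / (q - 1)`, and let `ψ` be a nontrivial additive
character of `F`.

The defining set `D` is stable under `Fˣ`, so counting the zeros of `c_b` with the characters of `F`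
gives `q w(c_b) = (q - 1) (|D| - S)` with the single character sum
`S = ∑ d ∈ D, ψ (Tr_{L/F} (b d))` (`card_mul_hammingNorm_codeword`). The condition
`Tr_{K/F} (N_{L/K} d) = 0` depends only on the class of `N_{L/K} d` in `Kˣ / Fˣ`, a cyclic group of
order `N` whose characters are the powers of any `φ` of order `N`. Fourier expansion
(`sum_definingSet_eq`) therefore writes `S` as a sum over `j < N` of two factors:

* the Gauss sum over `L` of the lift of `φ ^ j` along the norm. By the Hasse–Davenport relation
  (`hasseDavenport_lift`) it is `(-1) ^ (m - 1) G(φ ^ j) ^ m`;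
* the sum of `φ ^ (-j)` over the elements of trace zero of `K`. For `j ≠ 0` it is
  `(q - 1) / q * G(φ ^ (-j))` (`card_mul_sum_trace_eq_zero`).

Since `G(χ) G(χ⁻¹) = χ(-1) Q`, this is the weight formula (`hammingNorm_codeword_eq`). As `|G(χ)| = √Q`
for `χ ≠ 1`, the triangle inequality bounds the weights below (`le_hammingNorm_codeword`). The bound
is positive because `f < k`, so `b ↦ c_b` is injective and the code has dimension `k`.

The Hasse–Davenport relation is proved through the completely multiplicative function
`w(h) = χ((-1) ^ n h(0)) ψ(-a)` on monic polynomials `h = X ^ n + a X ^ (n - 1) + ⋯` over `K`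
(`polyWeight`). Let `S_n` be the sum of `w` over the monic polynomials of degree `n`. Then `S_0 = 1`,
`S_1 = G(χ)`, and `S_n = 0` for `n ≥ 2`. Counting degrees of irreducible factors gives
`n S_n = ∑ deg P * w(P) ^ j * S_{n - j deg P}`, the sum being over irreducible `P` and `j ≥ 1`
with `j deg P ≤ n`. So the sums `A_n = ∑ deg P * w(P) ^ j` over the prime powers `P ^ j` of degree `n`
satisfy `A_1 = G(χ)` and `A_n = -G(χ) A_{n-1}` (`primePowerSum_eq`); grouping the elements of `L` by
minimal polynomial identifies `A_m` with the Gauss sum over `L`.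
-/

/-! ### The Hasse–Davenport relation -/

section HasseDavenport

open Polynomial

variable {K R : Type*} [Field K] [CommRing R]

theorem finite_setOf_monic_natDegree_eq [Finite K] (n : ℕ) :
    {f : K[X] | f.Monic ∧ f.natDegree = n}.Finite := by
  have : Finite (degreeLT K n) := Finite.of_equiv _ (degreeLTEquiv K n).symm.toEquiv
  exact Set.finite_coe_iff.1 (Finite.of_equiv _ (monicEquivDegreeLT n).symm)

/-- The finite set of monic polynomials of degree `n` over a finite field. -/
noncomputable def monicsOfDegree (K : Type*) [Field K] [Finite K] (n : ℕ) : Finset K[X] :=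
  (finite_setOf_monic_natDegree_eq n).toFinset

@[simp]
theorem mem_monicsOfDegree [Finite K] {n : ℕ} {f : K[X]} :
    f ∈ monicsOfDegree K n ↔ f.Monic ∧ f.natDegree = n := by
  simp [monicsOfDegree]

open Classical in
/-- The finite set of monic irreducible polynomials of degree at most `B` over a finite field. -/
noncomputable def monicIrreducibles (K : Type*) [Field K] [Finite K] (B : ℕ) : Finset K[X] :=
  {P ∈ (Finset.range (B + 1)).biUnion (monicsOfDegree K) | Irreducible P}

theorem mem_monicIrreducibles [Finite K] {B : ℕ} {P : K[X]} :
    P ∈ monicIrreducibles K B ↔ P.Monic ∧ P.natDegree ≤ B ∧ Irreducible P := by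
  simp [monicIrreducibles]
  grind

/-- The function `f ↦ χ(c) ψ(s)` on monic polynomials over `K`, where `c` is the product and `s`
the sum of the roots of `f`. -/
noncomputable def polyWeight (χ : MulChar K R) (ψ : AddChar K R) (f : K[X]) : R :=
  χ ((-1) ^ f.natDegree * f.coeff 0) * ψ (-f.nextCoeff)

theorem polyWeight_one (χ : MulChar K R) (ψ : AddChar K R) : polyWeight χ ψ 1 = 1 := by
  simp [polyWeight, nextCoeff]

theorem polyWeight_mul (χ : MulChar K R) (ψ : AddChar K R) {f g : K[X]}
    (hf : f.Monic) (hg : g.Monic) :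
    polyWeight χ ψ (f * g) = polyWeight χ ψ f * polyWeight χ ψ g := by
  have h : (-1 : K) ^ (f * g).natDegree * (f * g).coeff 0
      = ((-1) ^ f.natDegree * f.coeff 0) * ((-1) ^ g.natDegree * g.coeff 0) := by
    rw [hf.natDegree_mul hg, mul_coeff_zero]
    ring
  rw [polyWeight, h, hf.nextCoeff_mul hg, neg_add, map_mul, AddChar.map_add_eq_mul]
  simp only [polyWeight]
  ring

theorem polyWeight_pow (χ : MulChar K R) (ψ : AddChar K R) {f : K[X]} (hf : f.Monic) (j : ℕ) :
    polyWeight χ ψ (f ^ j) = polyWeight χ ψ f ^ j := by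
  induction j with
  | zero => simp [polyWeight_one]
  | succ j ih => rw [pow_succ, polyWeight_mul χ ψ (hf.pow j) hf, ih, pow_succ]

/-- The value of `polyWeight` at the characteristic polynomial of `x`, which is a power of the
minimal polynomial. -/
theorem mulChar_norm_mul_addChar_trace {L : Type*} [Field L] [Algebra K L] [FiniteDimensional K L]
    (χ : MulChar K R) (ψ : AddChar K R) (x : L) :
    χ (Algebra.norm K x) * ψ (Algebra.trace K L x)
      = polyWeight χ ψ (minpoly K x) ^ (Module.finrank K L / (minpoly K x).natDegree) := by
  have hx : IsIntegral K x := .of_finite K x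
  have hd : Module.finrank K (IntermediateField.adjoin K {x}) = (minpoly K x).natDegree :=
    IntermediateField.adjoin.finrank hx
  have hpos : 0 < (minpoly K x).natDegree := minpoly.natDegree_pos hx
  have hr : Module.finrank K L / (minpoly K x).natDegree
      = Module.finrank (IntermediateField.adjoin K {x}) L := by
    rw [← Module.finrank_mul_finrank K (IntermediateField.adjoin K {x}) L, hd,
      Nat.mul_div_cancel_left _ hpos]
  have hn : Algebra.norm K (IntermediateField.AdjoinSimple.gen K x)
      = (-1) ^ (minpoly K x).natDegree * (minpoly K x).coeff 0 := by
    have := Algebra.PowerBasis.norm_gen_eq_coeff_zero_minpoly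
      (IntermediateField.adjoin.powerBasis hx)
    rwa [IntermediateField.adjoin.powerBasis_gen, IntermediateField.adjoin.powerBasis_dim,
      IntermediateField.minpoly_gen] at this
  rw [Algebra.norm_eq_norm_adjoin, trace_eq_finrank_mul_minpoly_nextCoeff, hn, hr, map_pow,
    ← nsmul_eq_mul, AddChar.map_nsmul_eq_pow, polyWeight, mul_pow]

variable [Finite K]

/-- The sum of `polyWeight` over the monic polynomials of degree `n`. -/
noncomputable def polyWeightSum (χ : MulChar K R) (ψ : AddChar K R) (n : ℕ) : R :=
  ∑ f ∈ monicsOfDegree K n, polyWeight χ ψ f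

theorem polyWeightSum_zero (χ : MulChar K R) (ψ : AddChar K R) : polyWeightSum χ ψ 0 = 1 := by
  have : monicsOfDegree K 0 = {1} := by
    ext f
    simp only [mem_monicsOfDegree, Finset.mem_singleton]
    exact ⟨fun h => h.1.natDegree_eq_zero.1 h.2, fun h => by simp [h, monic_one]⟩
  simp [polyWeightSum, this, polyWeight_one]

theorem polyWeightSum_one {K : Type*} [Field K] [Fintype K] (χ : MulChar K R) (ψ : AddChar K R) :
    polyWeightSum χ ψ 1 = gaussSum χ ψ := by
  symm
  refine Finset.sum_bij (fun a _ => X - C a) (fun a _ => ?_) (fun a _ b _ h => ?_)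
    (fun f hf => ?_) (fun a _ => ?_)
  · simp [monic_X_sub_C]
  · simpa using h
  · rw [mem_monicsOfDegree] at hf
    refine ⟨-f.coeff 0, Finset.mem_univ _, ?_⟩
    rw [map_neg, sub_neg_eq_add]
    exact (hf.1.eq_X_add_C hf.2).symm
  · simp [polyWeight]

/-- Adding `a X ^ (n - 1)` permutes the monic polynomials of degree `n ≥ 2`, keeps the constant
coefficient, and multiplies `polyWeight` by `ψ (-a)`. -/
theorem polyWeightSum_eq_zero [IsDomain R] (χ : MulChar K R) {ψ : AddChar K R} (hψ : ψ ≠ 1)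
    {n : ℕ} (hn : 2 ≤ n) : polyWeightSum χ ψ n = 0 := by
  obtain ⟨a, ha⟩ := AddChar.ne_one_iff.1 hψ
  have hdeg (c : K) : (C c * X ^ (n - 1)).natDegree < n :=
    (natDegree_C_mul_X_pow_le _ _).trans_lt (by omega)
  have hmem (c : K) (f : K[X]) (hf : f ∈ monicsOfDegree K n) :
      f + C c * X ^ (n - 1) ∈ monicsOfDegree K n := by
    rw [mem_monicsOfDegree] at hf ⊢
    have h : (C c * X ^ (n - 1)).natDegree < f.natDegree := by rw [hf.2]; exact hdeg c
    exact ⟨hf.1.add_of_left (degree_lt_degree h),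
      by rw [natDegree_add_eq_left_of_natDegree_lt h, hf.2]⟩
  have key : polyWeightSum χ ψ n = ψ a * polyWeightSum χ ψ n := by
    rw [polyWeightSum, Finset.mul_sum]
    symm
    refine Finset.sum_bij' (fun f _ => f + C (-a) * X ^ (n - 1)) (fun f _ => f + C a * X ^ (n - 1))
      (fun f hf => hmem _ f hf) (fun f hf => hmem _ f hf) (fun f _ => by simp) (fun f _ => by simp)
      fun f hf => ?_
    have h := (mem_monicsOfDegree.1 (hmem (-a) f hf)).2
    have hf' := (mem_monicsOfDegree.1 hf).2
    rw [polyWeight, polyWeight, h, hf', nextCoeff_of_natDegree_pos (by omega),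
      nextCoeff_of_natDegree_pos (by omega), h, hf']
    have h0 : ¬ 0 = n - 1 := by omega
    simp only [coeff_add, coeff_C_mul, coeff_X_pow, if_neg h0]
    simp only [mul_zero, add_zero, if_true, mul_one, neg_add, neg_neg, AddChar.map_add_eq_mul]
    ring
  have : (ψ a - 1) * polyWeightSum χ ψ n = 0 := by linear_combination -key
  exact (mul_eq_zero.1 this).resolve_left (sub_ne_zero.2 ha)

open Classical in
/-- The degree of `f` is the sum of the degrees of the prime powers dividing it, each prime power
`P ^ j` being counted with the degree of `P`. -/
theorem natDegree_eq_sum_monicIrreducibles {f : K[X]} (hf : f.Monic) {B : ℕ}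
    (hB : f.natDegree ≤ B) :
    f.natDegree = ∑ P ∈ monicIrreducibles K B, ∑ j ∈ Finset.Icc 1 B,
      if P ^ j ∣ f then P.natDegree else 0 := by
  have hf0 := hf.ne_zero
  set s := UniqueFactorizationMonoid.normalizedFactors f
  have hmonic : ∀ P ∈ s, P.Monic := fun P hP => by
    have := UniqueFactorizationMonoid.normalize_normalized_factor P hP
    rw [← this]
    exact monic_normalize (UniqueFactorizationMonoid.irreducible_of_normalized_factor P hP).ne_zero
  have hprod : s.prod = f :=
    eq_of_monic_of_associated (by simpa using monic_multiset_prod_of_monic s id hmonic) hf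
      (UniqueFactorizationMonoid.prod_normalizedFactors hf0)
  have hsub : s.toFinset ⊆ monicIrreducibles K B := fun P hP => by
    rw [Multiset.mem_toFinset] at hP
    exact mem_monicIrreducibles.2 ⟨hmonic P hP, (natDegree_le_of_dvd
      (UniqueFactorizationMonoid.dvd_of_mem_normalizedFactors hP) hf0).trans hB,
      UniqueFactorizationMonoid.irreducible_of_normalized_factor P hP⟩
  have h1 : f.natDegree = (s.map natDegree).sum := by
    conv_lhs => rw [← hprod]
    exact natDegree_multiset_prod_of_monic s hmonic
  rw [h1, Finset.sum_multiset_map_count, Finset.sum_subset hsub fun P _ hP => by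
    rw [Multiset.count_eq_zero_of_notMem (by simpa using hP), zero_smul]]
  refine Finset.sum_congr rfl fun P hP => ?_
  obtain ⟨hPm, hPB, hPi⟩ := mem_monicIrreducibles.1 hP
  have hcount (j : ℕ) : P ^ j ∣ f ↔ j ≤ s.count P := by
    rw [pow_dvd_iff_le_emultiplicity,
      UniqueFactorizationMonoid.emultiplicity_eq_count_normalizedFactors hPi hf0,
      hPm.normalize_eq_self, Nat.cast_le]
  have hle : s.count P ≤ B := by
    have := natDegree_le_of_dvd ((hcount _).2 le_rfl) hf0
    rw [natDegree_pow] at this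
    nlinarith [hPi.natDegree_pos]
  rw [← Finset.sum_filter, Finset.sum_const]
  have : {j ∈ Finset.Icc 1 B | P ^ j ∣ f} = Finset.Icc 1 (s.count P) := by
    ext j
    rw [Finset.mem_filter, Finset.mem_Icc, Finset.mem_Icc, hcount]
    omega
  rw [this, Nat.card_Icc, Nat.add_sub_cancel]

open Classical in
/-- The monic multiples of `P ^ j` of degree `n` are the `P ^ j * g` with `g` monic of degree
`n - j * deg P`, and `polyWeight` is multiplicative. -/
theorem sum_polyWeight_of_pow_dvd (χ : MulChar K R) (ψ : AddChar K R) {P : K[X]} (hP : P.Monic)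
    (j n : ℕ) :
    (∑ f ∈ monicsOfDegree K n, if P ^ j ∣ f then polyWeight χ ψ f else 0)
      = if j * P.natDegree ≤ n then
          polyWeight χ ψ P ^ j * polyWeightSum χ ψ (n - j * P.natDegree) else 0 := by
  have hPj : (P ^ j).Monic := hP.pow j
  rw [← Finset.sum_filter]
  split_ifs with h
  · rw [polyWeightSum, Finset.mul_sum]
    symm
    refine Finset.sum_bij (fun h _ => P ^ j * h) (fun g hg => ?_) (fun g _ g' _ h => ?_)
      (fun f hf => ?_) (fun g hg => ?_)
    · rw [mem_monicsOfDegree] at hg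
      rw [Finset.mem_filter, mem_monicsOfDegree, hPj.natDegree_mul hg.1, hP.natDegree_pow, hg.2]
      exact ⟨⟨hPj.mul hg.1, by omega⟩, dvd_mul_right _ _⟩
    · exact mul_left_cancel₀ hPj.ne_zero h
    · obtain ⟨hf, g, rfl⟩ := Finset.mem_filter.1 hf
      rw [mem_monicsOfDegree] at hf
      have hg := hPj.of_mul_monic_left hf.1
      refine ⟨g, mem_monicsOfDegree.2 ⟨hg, ?_⟩, rfl⟩
      rw [← hf.2, hPj.natDegree_mul hg, hP.natDegree_pow]
      omega
    · rw [polyWeight_mul χ ψ hPj (mem_monicsOfDegree.1 hg).1, polyWeight_pow χ ψ hP]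
  · refine Finset.sum_eq_zero fun f hf => ?_
    obtain ⟨hf, hd⟩ := Finset.mem_filter.1 hf
    rw [mem_monicsOfDegree] at hf
    have := natDegree_le_of_dvd hd hf.1.ne_zero
    rw [hP.natDegree_pow, hf.2] at this
    exact absurd this h

/-- The sum of `deg P * w(P) ^ j` over all prime powers `P ^ j` of degree `n`, where `w` is
`polyWeight`. The bound `B` only makes the index set finite: any `B ≥ n` gives the same value. -/
noncomputable def primePowerSum (χ : MulChar K R) (ψ : AddChar K R) (B n : ℕ) : R :=
  ∑ P ∈ monicIrreducibles K B, ∑ j ∈ Finset.Icc 1 B,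
    if j * P.natDegree = n then (P.natDegree : R) * polyWeight χ ψ P ^ j else 0

/-- The logarithmic derivative of the Euler product of the generating series of `polyWeightSum`,
compared in degree `n`. -/
theorem natCast_mul_polyWeightSum (χ : MulChar K R) (ψ : AddChar K R) {B n : ℕ}
    (hn : n ≤ B) :
    (n : R) * polyWeightSum χ ψ n = ∑ P ∈ monicIrreducibles K B, ∑ j ∈ Finset.Icc 1 B,
      if j * P.natDegree ≤ n then (P.natDegree : R) * polyWeight χ ψ P ^ j *
        polyWeightSum χ ψ (n - j * P.natDegree) else 0 := by
  classical
  have h1 : (n : R) * polyWeightSum χ ψ n = ∑ f ∈ monicsOfDegree K n,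
      ∑ P ∈ monicIrreducibles K B, ∑ j ∈ Finset.Icc 1 B,
        P.natDegree * if P ^ j ∣ f then polyWeight χ ψ f else 0 := by
    rw [polyWeightSum, Finset.mul_sum]
    refine Finset.sum_congr rfl fun f hf => ?_
    obtain ⟨hfm, hfn⟩ := mem_monicsOfDegree.1 hf
    rw [← hfn, natDegree_eq_sum_monicIrreducibles hfm (hfn.trans_le hn)]
    push_cast
    simp only [Finset.sum_mul]
    refine Finset.sum_congr rfl fun P _ => Finset.sum_congr rfl fun j _ => ?_
    split_ifs <;> simp
  rw [h1, Finset.sum_comm]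
  refine Finset.sum_congr rfl fun P hP => ?_
  rw [Finset.sum_comm]
  refine Finset.sum_congr rfl fun j _ => ?_
  rw [← Finset.mul_sum, sum_polyWeight_of_pow_dvd χ ψ (mem_monicIrreducibles.1 hP).1]
  split_ifs <;> simp [mul_assoc]

/-- In `natCast_mul_polyWeightSum` only the prime powers of degrees `n` and `n - 1` contribute, which
gives a recursion of length one. -/
theorem primePowerSum_eq {K : Type*} [Field K] [Fintype K] [IsDomain R] (χ : MulChar K R)
    {ψ : AddChar K R} (hψ : ψ ≠ 1) {B n : ℕ} (hn : 1 ≤ n) (hB : n ≤ B) :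
    primePowerSum χ ψ B n = (-1) ^ (n - 1) * gaussSum χ ψ ^ n := by
  have hpos {P : K[X]} (hP : P ∈ monicIrreducibles K B) {j : ℕ} (hj : j ∈ Finset.Icc 1 B) :
      0 < j * P.natDegree :=
    mul_pos (Finset.mem_Icc.1 hj).1 (mem_monicIrreducibles.1 hP).2.2.natDegree_pos
  induction n, hn using Nat.le_induction with
  | base =>
    have h := natCast_mul_polyWeightSum χ ψ hB
    rw [polyWeightSum_one, Nat.cast_one, one_mul] at h
    rw [h, primePowerSum, Nat.sub_self, pow_zero, one_mul, pow_one]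
    refine Finset.sum_congr rfl fun P hP => Finset.sum_congr rfl fun j hj => ?_
    have := hpos hP hj
    split_ifs with h1 h2 h2
    · rw [h1, Nat.sub_self, polyWeightSum_zero, mul_one]
    · omega
    · omega
    · rfl
  | succ n hn ih =>
    have h := natCast_mul_polyWeightSum χ ψ hB
    rw [polyWeightSum_eq_zero χ hψ (by omega), mul_zero] at h
    have h2 : primePowerSum χ ψ B (n + 1) + primePowerSum χ ψ B n * gaussSum χ ψ = 0 := by
      rw [h, primePowerSum, primePowerSum, Finset.sum_mul, ← Finset.sum_add_distrib]
      refine Finset.sum_congr rfl fun P hP => ?_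
      rw [Finset.sum_mul, ← Finset.sum_add_distrib]
      refine Finset.sum_congr rfl fun j hj => ?_
      have := hpos hP hj
      rcases lt_trichotomy (j * P.natDegree) n with hlt | heq | hgt
      · rw [if_neg (by omega), if_neg (by omega), if_pos (by omega),
          polyWeightSum_eq_zero χ hψ (by omega)]
        simp
      · rw [if_neg (by omega), if_pos heq, if_pos (by omega), heq, Nat.add_sub_cancel_left,
          polyWeightSum_one]
        simp
      · rw [if_neg (by omega : ¬ j * P.natDegree = n)]
        rcases eq_or_ne (j * P.natDegree) (n + 1) with heq | hne
        · rw [if_pos heq, if_pos heq.le, heq, Nat.sub_self, polyWeightSum_zero]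
          simp
        · rw [if_neg hne, if_neg (by omega)]
          simp
    rw [ih (by omega)] at h2
    obtain ⟨m, rfl⟩ : ∃ m, n = m + 1 := ⟨n - 1, by omega⟩
    simp only [Nat.add_sub_cancel] at h2 ⊢
    linear_combination h2

open Classical in
/-- In an extension `L` of degree `m`, an irreducible polynomial `P` whose degree divides `m` is
the minimal polynomial of exactly `deg P` elements. -/
theorem card_filter_minpoly_eq {L : Type*} [Field L] [Fintype L] [Algebra K L] {P : K[X]}
    (hP : P.Monic) (hPi : Irreducible P) (hd : P.natDegree ∣ Module.finrank K L) :
    (Finset.univ.filter fun x : L => minpoly K x = P).card = P.natDegree := by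
  have hsplit : (P.map (algebraMap K L)).Splits := by
    have h := hPi.natDegree_dvd_iff_dvd_X_pow_card_pow_sub_X.1 hd
    rw [← Module.natCard_eq_pow_finrank] at h
    refine (Polynomial.splits_X_pow_nat_card_sub_X (K := L)).of_dvd
      (FiniteField.X_pow_card_sub_X_ne_zero L Finite.one_lt_card) ?_
    simpa using Polynomial.map_dvd (algebraMap K L) h
  rw [← card_rootSet_eq_natDegree (K := L) (PerfectField.separable_of_irreducible hPi) hsplit,
    ← Set.toFinset_card]
  congr 1
  ext x
  rw [Finset.mem_filter, Set.mem_toFinset, mem_rootSet]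
  refine ⟨fun h => ⟨hPi.ne_zero, h.2 ▸ minpoly.aeval K x⟩, fun h => ⟨Finset.mem_univ _, ?_⟩⟩
  exact (minpoly.eq_of_irreducible_of_monic hPi h.2 hP).symm

/-- The Hasse–Davenport lifting relation: if `ψ` is nontrivial, the Gauss sum of the lifts of `χ`
and `ψ` along the norm and trace of `L / K`, up to sign, is a power of the Gauss sum of `χ` and
`ψ`. -/
theorem hasseDavenport_lift {K L : Type*} [Field K] [Field L] [Fintype K] [Fintype L] [Algebra K L]
    [IsDomain R] (χ : MulChar K R) {ψ : AddChar K R} (hψ : ψ ≠ 1) :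
    ∑ x : L, χ (Algebra.norm K x) * ψ (Algebra.trace K L x)
      = (-1) ^ (Module.finrank K L - 1) * gaussSum χ ψ ^ Module.finrank K L := by
  classical
  have hm : 1 ≤ Module.finrank K L := Module.finrank_pos
  rw [← primePowerSum_eq χ hψ hm le_rfl, primePowerSum,
    ← Finset.sum_fiberwise_of_maps_to (s := Finset.univ) (g := minpoly K)
      (t := monicIrreducibles K (Module.finrank K L))
      fun x _ => mem_monicIrreducibles.2 ⟨minpoly.monic (.of_finite K x),
        Nat.le_of_dvd hm (minpoly.degree_dvd (.of_finite K x)),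
        minpoly.irreducible (.of_finite K x)⟩]
  refine Finset.sum_congr rfl fun P hP => ?_
  obtain ⟨hPm, hPB, hPi⟩ := mem_monicIrreducibles.1 hP
  have hpos := hPi.natDegree_pos
  by_cases hd : P.natDegree ∣ Module.finrank K L
  · obtain ⟨j, hj⟩ := id hd
    have hj1 : 1 ≤ j := by
      by_contra h
      obtain rfl : j = 0 := by omega
      omega
    rw [Finset.sum_congr rfl (g := fun _ => polyWeight χ ψ P ^ j) fun x hx => by
        rw [mulChar_norm_mul_addChar_trace, (Finset.mem_filter.1 hx).2, hj,
          Nat.mul_div_cancel_left _ hpos],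
      Finset.sum_const, card_filter_minpoly_eq hPm hPi hd, nsmul_eq_mul,
      Finset.sum_eq_single_of_mem j, if_pos (by rw [hj, mul_comm])]
    · exact Finset.mem_Icc.2 ⟨hj1, by nlinarith⟩
    · intro i _ hij
      rw [if_neg]
      rw [hj, mul_comm]
      exact fun h => hij (Nat.eq_of_mul_eq_mul_left hpos h)
  · rw [Finset.sum_eq_zero fun j _ => if_neg fun h => hd ⟨j, by rw [← h, mul_comm]⟩,
      Finset.sum_eq_zero]
    intro x hx
    exact absurd ((Finset.mem_filter.1 hx).2 ▸ minpoly.degree_dvd (.of_finite K x)) hd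

end HasseDavenport

/-! ### Character sums over the defining set -/

section CharacterSums

variable {F K L : Type*} [Field F] [Field K] [Field L] [Algebra F K] [Algebra F L] [Algebra K L]

/-- The additive character `ψ ∘ Tr` of `K` obtained from an additive character `ψ` of `F`. -/
noncomputable def traceAddChar (K : Type*) [Field K] [Algebra F K] (ψ : AddChar F ℂ) :
    AddChar K ℂ :=
  ψ.compAddMonoidHom (Algebra.trace F K).toAddMonoidHom

theorem traceAddChar_apply (ψ : AddChar F ℂ) (x : K) :
    traceAddChar K ψ x = ψ (Algebra.trace F K x) := rfl

theorem smul_mem_definingSet [Fintype L] [DecidableEq F] [DecidableEq L] [IsScalarTower F K L]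
    {u : F} (hu : u ≠ 0) {d : L}
    (hd : d ∈ definingSet F K L) : u • d ∈ definingSet F K L := by
  simp only [definingSet, Finset.mem_filter, Finset.mem_univ, true_and] at hd ⊢
  refine ⟨smul_ne_zero hu hd.1, ?_⟩
  rw [← algebraMap_smul K u d, Algebra.smul_def, map_mul, Algebra.norm_algebraMap, ← map_pow,
    ← Algebra.smul_def, map_smul, hd.2, smul_zero]

variable [Fintype F] [Fintype L]

theorem sum_addChar_mul [DecidableEq F] {ψ : AddChar F ℂ} (hψ : ψ ≠ 1) (t : F) :
    ∑ u, ψ (u * t) = if t = 0 then (Fintype.card F : ℂ) else 0 := by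
  rw [AddChar.sum_mulShift t (AddChar.IsPrimitive.of_ne_one hψ)]
  split_ifs <;> simp

/-- The Hamming weight of a codeword as a character sum over the defining set; the defining set is
stable under multiplication by `Fˣ`, so all nontrivial characters of `F` contribute equally. -/
theorem card_mul_hammingNorm_codeword [DecidableEq F] [DecidableEq L] [IsScalarTower F K L]
    {ψ : AddChar F ℂ} (hψ : ψ ≠ 1) (b : L) :
    (Fintype.card F : ℂ) * hammingNorm (codeword F (definingSet F K L) b)
      = ((Fintype.card F : ℂ) - 1) * ((definingSet F K L).card
          - ∑ d ∈ definingSet F K L, ψ (Algebra.trace F L (b * d))) := by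
  set D := definingSet F K L
  have hw : hammingNorm (codeword F D b)
      = (D.filter fun d => ¬ Algebra.trace F L (b * d) = 0).card := by
    rw [hammingNorm, Finset.card_filter, Finset.card_filter]
    exact Finset.sum_coe_sort D fun d => if ¬ Algebra.trace F L (b * d) = 0 then 1 else 0
  have hsplit : ((D.filter fun d => Algebra.trace F L (b * d) = 0).card : ℂ)
      + (D.filter fun d => ¬ Algebra.trace F L (b * d) = 0).card = D.card := by
    exact_mod_cast Finset.card_filter_add_card_filter_not (s := D) _
  have h1 : ∑ d ∈ D, ∑ u, ψ (u * Algebra.trace F L (b * d))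
      = (Fintype.card F : ℂ) * (D.filter fun d => Algebra.trace F L (b * d) = 0).card := by
    simp_rw [sum_addChar_mul hψ]
    rw [← Finset.sum_filter, Finset.sum_const, nsmul_eq_mul, mul_comm]
  have h2 (u : F) (hu : u ≠ 0) : ∑ d ∈ D, ψ (u * Algebra.trace F L (b * d))
      = ∑ d ∈ D, ψ (Algebra.trace F L (b * d)) := by
    refine Finset.sum_bij' (fun d _ => u • d) (fun d _ => u⁻¹ • d)
      (fun d hd => smul_mem_definingSet hu hd) (fun d hd => smul_mem_definingSet (inv_ne_zero hu) hd)
      (fun d _ => inv_smul_smul₀ hu d) (fun d _ => smul_inv_smul₀ hu d) fun d _ => ?_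
    rw [mul_smul_comm, map_smul, smul_eq_mul]
  rw [Finset.sum_comm, ← Finset.add_sum_erase _ _ (Finset.mem_univ (0 : F)),
    Finset.sum_congr rfl fun u hu => h2 u (Finset.ne_of_mem_erase hu), Finset.sum_const,
    Finset.card_erase_of_mem (Finset.mem_univ _), Finset.card_univ, nsmul_eq_mul,
    Nat.cast_sub Fintype.card_pos] at h1
  simp only [zero_mul, AddChar.map_zero_eq_one, Finset.sum_const, nsmul_eq_mul, mul_one,
    Nat.cast_one] at h1
  rw [hw]
  linear_combination h1 + (Fintype.card F : ℂ) * hsplit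

variable [Fintype K]

theorem traceAddChar_ne_one {ψ : AddChar F ℂ} (hψ : ψ ≠ 1) : traceAddChar K ψ ≠ 1 := by
  obtain ⟨a, ha⟩ := AddChar.ne_one_iff.1 hψ
  obtain ⟨x, rfl⟩ := Algebra.trace_surjective F K a
  exact AddChar.ne_one_iff.2 ⟨x, ha⟩

/-- Summing a multiplicative character that is trivial on `Fˣ` over the elements of trace zero
gives its Gauss sum, up to a factor. -/
theorem card_mul_sum_trace_eq_zero [DecidableEq F] {ψ : AddChar F ℂ} (hψ : ψ ≠ 1)
    {χ : MulChar K ℂ} (hχ : χ ≠ 1)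
    (hχF : ∀ u : F, u ≠ 0 → χ (algebraMap F K u) = 1) :
    (Fintype.card F : ℂ) * ∑ x : K with Algebra.trace F K x = 0, χ x
      = ((Fintype.card F : ℂ) - 1) * gaussSum χ (traceAddChar K ψ) := by
  have h1 : ∑ x : K, ∑ u, χ x * ψ (u * Algebra.trace F K x)
      = (Fintype.card F : ℂ) * ∑ x : K with Algebra.trace F K x = 0, χ x := by
    simp_rw [← Finset.mul_sum, sum_addChar_mul hψ]
    rw [Finset.sum_filter, Finset.mul_sum]
    refine Finset.sum_congr rfl fun x _ => ?_
    split_ifs <;> ring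
  have h2 (u : F) (hu : u ≠ 0) : ∑ x : K, χ x * ψ (u * Algebra.trace F K x)
      = gaussSum χ (traceAddChar K ψ) := by
    rw [gaussSum]
    refine Fintype.sum_bijective (fun x => u • x) (MulAction.bijective₀ hu) _ _ fun x => ?_
    rw [traceAddChar_apply, LinearMap.map_smul, smul_eq_mul, Algebra.smul_def, map_mul χ, hχF u hu,
      one_mul]
  rw [← h1, Finset.sum_comm, ← Finset.add_sum_erase _ _ (Finset.mem_univ (0 : F)),
    Finset.sum_congr rfl fun u hu => h2 u (Finset.ne_of_mem_erase hu), Finset.sum_const,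
    Finset.card_erase_of_mem (Finset.mem_univ _), Finset.card_univ, nsmul_eq_mul,
    Nat.cast_sub Fintype.card_pos]
  simp only [zero_mul, AddChar.map_zero_eq_one, mul_one, MulChar.sum_eq_zero_of_ne_one hχ, zero_add,
    Nat.cast_one]

theorem apply_algebraMap_of_orderOf_eq {φ : MulChar K ℂ}
    (hφ : orderOf φ = (Fintype.card K - 1) / (Fintype.card F - 1))
    {u : F} (hu : u ≠ 0) : φ (algebraMap F K u) = 1 := by
  obtain ⟨v, rfl⟩ := FiniteField.norm_surjective F K u
  have hv : v ≠ 0 := by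
    rintro rfl
    exact hu (Algebra.norm_zero ..)
  rw [algebraMap_norm_eq_power, ← hφ, map_pow, ← MulChar.pow_apply' _ φ.orderOf_pos.ne',
    pow_orderOf_eq_one, MulChar.one_apply hv.isUnit]

/-- The kernel of a character of order `|Kˣ| / |Fˣ|` is `Fˣ`. -/
theorem apply_eq_one_iff_of_orderOf_eq {φ : MulChar K ℂ}
    (hφ : orderOf φ = (Fintype.card K - 1) / (Fintype.card F - 1))
    {z : K} (hz : z ≠ 0) :
    φ z = 1 ↔ ∃ u : F, u ≠ 0 ∧ algebraMap F K u = z := by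
  refine ⟨fun h => ?_, ?_⟩
  · obtain ⟨g, hg⟩ := IsCyclic.exists_generator (α := Kˣ)
    obtain ⟨i, hi⟩ := (mem_powers_iff_mem_zpowers (x := g)).2 (hg (Units.mk0 z hz))
    have hzi : z = (g : K) ^ i := by
      have := congrArg Units.val hi
      simpa using this.symm
    -- A character of a cyclic group is determined by its value at the generator `g`.
    have hord : orderOf φ ∣ orderOf (φ g) := by
      refine orderOf_dvd_of_pow_eq_one ?_
      ext a
      obtain ⟨l, hl⟩ := (mem_powers_iff_mem_zpowers (x := g)).2 (hg a)
      rw [MulChar.one_apply_coe, MulChar.pow_apply_coe, ← hl]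
      simp only [Units.val_pow_eq_pow_val, map_pow]
      rw [← pow_mul, mul_comm, pow_mul, pow_orderOf_eq_one, one_pow]
    have hdvd : orderOf φ ∣ i := hord.trans <| orderOf_dvd_of_pow_eq_one <| by
      rw [← map_pow, ← hzi, h]
    obtain ⟨l, rfl⟩ := hdvd
    have hnorm : algebraMap F K (Algebra.norm F ((g : K) ^ l)) = z := by
      rw [algebraMap_norm_eq_power, ← hφ, hzi, ← pow_mul, mul_comm]
    refine ⟨_, ?_, hnorm⟩
    intro h0
    rw [h0, map_zero] at hnorm
    exact hz hnorm.symm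
  · rintro ⟨u, hu, rfl⟩
    exact apply_algebraMap_of_orderOf_eq hφ hu

/-- Orthogonality: the powers of `φ` are the characters of `Kˣ / Fˣ`. -/
theorem sum_range_pow_apply [DecidableEq F] [DecidableEq K] {φ : MulChar K ℂ}
    (hφ : orderOf φ = (Fintype.card K - 1) / (Fintype.card F - 1))
    {a : K} (ha : a ≠ 0) (x : K) :
    ∑ j ∈ Finset.range (orderOf φ), (φ ^ j) (a * x⁻¹)
      = orderOf φ * ∑ u ∈ Finset.univ.erase (0 : F), if x = u • a then 1 else 0 := by
  rcases eq_or_ne x 0 with rfl | hx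
  · rw [Finset.sum_eq_zero fun j _ => by rw [inv_zero, mul_zero, MulChar.map_zero],
      Finset.sum_eq_zero, mul_zero]
    intro u hu
    rw [if_neg (smul_ne_zero (Finset.ne_of_mem_erase hu) ha).symm]
  have hz : a * x⁻¹ ≠ 0 := mul_ne_zero ha (inv_ne_zero hx)
  have hpow (j : ℕ) : (φ ^ j) (a * x⁻¹) = φ (a * x⁻¹) ^ j :=
    MulChar.pow_apply_coe φ j (Units.mk0 _ hz)
  simp_rw [hpow]
  by_cases h : φ (a * x⁻¹) = 1
  · obtain ⟨u, hu, huz⟩ := (apply_eq_one_iff_of_orderOf_eq hφ hz).1 h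
    have hxu : x = u⁻¹ • a := by
      rw [Algebra.smul_def, map_inv₀, huz]
      field_simp
    rw [Finset.sum_eq_single_of_mem u⁻¹ (by simpa using hu), if_pos hxu, h]
    · simp
    · intro v _ hv
      rw [if_neg]
      rw [hxu]
      exact fun h => hv (smul_left_injective F ha h).symm
  · have hone : φ (a * x⁻¹) ^ orderOf φ = 1 := by
      rw [← hpow, pow_orderOf_eq_one, MulChar.one_apply hz.isUnit]
    have hgeom := mul_neg_geom_sum (φ (a * x⁻¹)) (orderOf φ)
    rw [hone, sub_self] at hgeom
    rw [(mul_eq_zero.1 hgeom).resolve_left (sub_ne_zero.2 (Ne.symm h)), Finset.sum_eq_zero,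
      mul_zero]
    intro u hu
    rw [if_neg]
    rintro rfl
    have hu0 := Finset.ne_of_mem_erase hu
    refine h ((apply_eq_one_iff_of_orderOf_eq hφ hz).2 ⟨u⁻¹, inv_ne_zero hu0, ?_⟩)
    rw [Algebra.smul_def, map_inv₀]
    field_simp

/-- Fourier expansion of the character sum over the defining set in the characters of `Kˣ / Fˣ`. -/
theorem sum_definingSet_eq [DecidableEq F] [DecidableEq L] {φ : MulChar K ℂ}
    (hφ : orderOf φ = (Fintype.card K - 1) / (Fintype.card F - 1))
    (ψ : AddChar F ℂ) {b : L} (hb : b ≠ 0) :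
    ((Fintype.card K : ℂ) - 1) * ∑ d ∈ definingSet F K L, ψ (Algebra.trace F L (b * d))
      = ∑ j ∈ Finset.range (orderOf φ), (starRingEnd ℂ) ((φ ^ j) (Algebra.norm K b))
          * (∑ y : L, (φ ^ j) (Algebra.norm K y) * ψ (Algebra.trace F L y))
          * ∑ x : K with Algebra.trace F K x = 0, (φ ^ j)⁻¹ x := by
  classical
  have hNb : Algebra.norm K b ≠ 0 := Algebra.norm_ne_zero_iff.2 hb
  -- The substitution `y = b * d` moves `b` from the additive character to the trace condition.
  have hS : ∑ d ∈ definingSet F K L, ψ (Algebra.trace F L (b * d))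
      = ∑ y ∈ Finset.univ.erase (0 : L),
        if Algebra.trace F K (Algebra.norm K y * (Algebra.norm K b)⁻¹) = 0
          then ψ (Algebra.trace F L y) else 0 := by
    rw [← Finset.sum_filter]
    refine Finset.sum_bij' (fun d _ => b * d) (fun y _ => b⁻¹ * y) (fun d hd => ?_) (fun y hy => ?_)
      (fun d _ => inv_mul_cancel_left₀ hb d) (fun y _ => mul_inv_cancel_left₀ hb y) fun d _ => rfl
    · simp only [definingSet, Finset.mem_filter, Finset.mem_univ, true_and, Finset.mem_erase,
        and_true] at hd ⊢
      refine ⟨mul_ne_zero hb hd.1, ?_⟩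
      rw [MonoidHom.map_mul, mul_right_comm, mul_inv_cancel₀ hNb, one_mul, hd.2]
    · simp only [definingSet, Finset.mem_filter, Finset.mem_univ, true_and, Finset.mem_erase,
        and_true] at hy ⊢
      refine ⟨mul_ne_zero (inv_ne_zero hb) hy.1, ?_⟩
      have hinv : Algebra.norm K b⁻¹ = (Algebra.norm K b)⁻¹ :=
        eq_inv_of_mul_eq_one_left
          (by rw [← MonoidHom.map_mul, inv_mul_cancel₀ hb, MonoidHom.map_one])
      rw [MonoidHom.map_mul, hinv, mul_comm, hy.2]
  have hcard : ((Fintype.card K : ℂ) - 1) = orderOf φ * ((Fintype.card F : ℂ) - 1) := by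
    have hdvd : Fintype.card F - 1 ∣ Fintype.card K - 1 := by
      rw [Module.card_eq_pow_finrank (K := F) (V := K)]
      simpa using Nat.sub_dvd_pow_sub_pow (Fintype.card F) 1 (Module.finrank F K)
    have := Nat.div_mul_cancel hdvd
    rw [← hφ] at this
    have h := congrArg (Nat.cast (R := ℂ)) this
    rw [Nat.cast_mul, Nat.cast_sub Fintype.card_pos, Nat.cast_sub Fintype.card_pos] at h
    simpa using h.symm
  have hterm (j : ℕ) (y : L) (x : K) :
      (starRingEnd ℂ) ((φ ^ j) (Algebra.norm K b)) *
        ((φ ^ j) (Algebra.norm K y) * ψ (Algebra.trace F L y)) * (φ ^ j)⁻¹ x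
      = ψ (Algebra.trace F L y)
        * (φ ^ j) (Algebra.norm K y * (Algebra.norm K b)⁻¹ * x⁻¹) := by
    rw [starRingEnd_apply, MulChar.star_apply', MulChar.inv_apply', MulChar.inv_apply', map_mul,
      map_mul]
    ring
  have hx (y : L) (hy : y ≠ 0) : ∑ x : K with Algebra.trace F K x = 0,
      ∑ u ∈ Finset.univ.erase (0 : F),
        (if x = u • (Algebra.norm K y * (Algebra.norm K b)⁻¹) then (1 : ℂ) else 0)
      = ((Fintype.card F : ℂ) - 1)
        * if Algebra.trace F K (Algebra.norm K y * (Algebra.norm K b)⁻¹) = 0 then 1 else 0 := by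
    rw [Finset.sum_comm]
    simp_rw [Finset.sum_ite_eq', Finset.mem_filter, Finset.mem_univ, true_and, map_smul]
    rw [Finset.sum_congr rfl fun u hu => if_congr
      (smul_eq_zero_iff_right (Finset.ne_of_mem_erase hu)) rfl rfl]
    rw [Finset.sum_const, Finset.card_erase_of_mem (Finset.mem_univ _), Finset.card_univ,
      nsmul_eq_mul, Nat.cast_sub Fintype.card_pos, Nat.cast_one]
  have hj (j : ℕ) : (starRingEnd ℂ) ((φ ^ j) (Algebra.norm K b))
        * (∑ y : L, (φ ^ j) (Algebra.norm K y) * ψ (Algebra.trace F L y))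
        * ∑ x : K with Algebra.trace F K x = 0, (φ ^ j)⁻¹ x
      = ∑ y : L, ∑ x : K with Algebra.trace F K x = 0, ψ (Algebra.trace F L y)
        * (φ ^ j) (Algebra.norm K y * (Algebra.norm K b)⁻¹ * x⁻¹) := by
    rw [Finset.mul_sum (a := (starRingEnd ℂ) _), Finset.sum_mul_sum]
    exact Finset.sum_congr rfl fun y _ => Finset.sum_congr rfl fun x _ => hterm j y x
  rw [Finset.sum_congr rfl fun j _ => hj j, Finset.sum_comm,
    ← Finset.add_sum_erase _ _ (Finset.mem_univ (0 : L)), hS, Finset.mul_sum]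
  convert (zero_add _).symm using 2
  · refine Finset.sum_eq_zero fun j _ => Finset.sum_eq_zero fun x _ => ?_
    rw [Algebra.norm_zero, zero_mul, zero_mul, MulChar.map_zero, mul_zero]
  · refine Finset.sum_congr rfl fun y hy => ?_
    have hy0 := Finset.ne_of_mem_erase hy
    have ha : Algebra.norm K y * (Algebra.norm K b)⁻¹ ≠ 0 :=
      mul_ne_zero (Algebra.norm_ne_zero_iff.2 hy0) (inv_ne_zero hNb)
    rw [Finset.sum_comm]
    simp_rw [← Finset.mul_sum, sum_range_pow_apply hφ ha]
    rw [← Finset.mul_sum, hx y hy0, hcard]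
    split_ifs <;> ring

end CharacterSums

/-! ### The size of the defining set -/

section Counting

variable {F K L : Type*} [Field F] [Field K] [Field L] [Algebra F K] [Algebra K L]

theorem card_trace_eq_zero [Fintype F] [Fintype K] [DecidableEq F] :
    (Finset.univ.filter fun x : K => Algebra.trace F K x = 0).card
      = Fintype.card F ^ (Module.finrank F K - 1) := by
  have hrank := LinearMap.finrank_range_add_finrank_ker (Algebra.trace F K)
  rw [LinearMap.range_eq_top.2 (Algebra.trace_surjective F K), finrank_top,
    Module.finrank_self] at hrank
  have hcard := Module.natCard_eq_pow_finrank (K := F) (V := LinearMap.ker (Algebra.trace F K))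
  rw [Nat.card_eq_fintype_card (α := F)] at hcard
  rw [← hrank, Nat.add_sub_cancel_left, ← hcard, ← Fintype.card_subtype,
    ← Nat.card_eq_fintype_card]
  rfl

variable [Fintype L]

theorem card_norm_eq [DecidableEq K] {x : K} (hx : x ≠ 0) :
    (Finset.univ.filter fun y : L => Algebra.norm K y = x).card
      = (Finset.univ.filter fun y : L => Algebra.norm K y = 1).card := by
  obtain ⟨z, rfl⟩ := FiniteField.norm_surjective K L x
  have hz : z ≠ 0 := by
    rintro rfl
    exact hx (Algebra.norm_zero ..)
  symm
  refine Finset.card_bij' (fun y _ => z * y) (fun y _ => z⁻¹ * y) (fun y hy => ?_) (fun y hy => ?_)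
    (fun y _ => inv_mul_cancel_left₀ hz y) (fun y _ => mul_inv_cancel_left₀ hz y)
  · simp only [Finset.mem_filter, Finset.mem_univ, true_and] at hy ⊢
    rw [MonoidHom.map_mul, hy, mul_one]
  · simp only [Finset.mem_filter, Finset.mem_univ, true_and] at hy ⊢
    rw [MonoidHom.map_mul, hy, ← MonoidHom.map_mul, inv_mul_cancel₀ hz, MonoidHom.map_one]

/-- Both `Lˣ` and the defining set are unions of fibres of the norm over nonzero elements of `K`, and
these fibres have equal size. -/
theorem card_definingSet_mul [Fintype F] [Fintype K] [DecidableEq F] [DecidableEq L] :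
    (definingSet F K L).card * (Fintype.card K - 1)
      = (Fintype.card L - 1) * (Fintype.card F ^ (Module.finrank F K - 1) - 1) := by
  classical
  set c := (Finset.univ.filter fun y : L => Algebra.norm K y = 1).card
  have hL : (Finset.univ.erase (0 : L)).card = (Fintype.card K - 1) * c := by
    rw [Finset.card_eq_sum_card_fiberwise (f := Algebra.norm K) (t := Finset.univ.erase (0 : K))]
    · rw [← Finset.card_univ (α := K), ← Finset.card_erase_of_mem (Finset.mem_univ (0 : K)),
        ← smul_eq_mul, ← Finset.sum_const]
      refine Finset.sum_congr rfl fun x hx => ?_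
      have hx0 := Finset.ne_of_mem_erase hx
      rw [show c = _ from (card_norm_eq hx0 (L := L)).symm]
      congr 1
      ext y
      simp only [Finset.mem_filter, Finset.mem_erase, Finset.mem_univ, and_true, true_and,
        and_iff_right_iff_imp]
      rintro rfl rfl
      exact hx0 (Algebra.norm_zero ..)
    · intro y hy
      simpa [Algebra.norm_ne_zero_iff] using hy
  have hD : (definingSet F K L).card = (Fintype.card F ^ (Module.finrank F K - 1) - 1) * c := by
    rw [Finset.card_eq_sum_card_fiberwise (f := Algebra.norm K)
      (t := (Finset.univ.filter fun x : K => Algebra.trace F K x = 0).erase 0)]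
    · rw [← card_trace_eq_zero (K := K), ← Finset.card_erase_of_mem (a := (0 : K)) (by simp),
        ← smul_eq_mul, ← Finset.sum_const]
      refine Finset.sum_congr rfl fun x hx => ?_
      have hx0 := Finset.ne_of_mem_erase hx
      have hxt := (Finset.mem_filter.1 (Finset.mem_of_mem_erase hx)).2
      rw [show c = _ from (card_norm_eq hx0 (L := L)).symm]
      congr 1
      ext y
      simp only [definingSet, Finset.mem_filter, Finset.mem_univ, true_and,
        and_iff_right_iff_imp]
      rintro rfl
      refine ⟨?_, hxt⟩
      rintro rfl
      exact hx0 (Algebra.norm_zero ..)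
    · intro y hy
      simpa [Algebra.norm_ne_zero_iff, definingSet, and_comm] using hy
  rw [Finset.card_erase_of_mem (Finset.mem_univ _), Finset.card_univ] at hL
  rw [hD, hL]
  ring

end Counting

/-! ### Products and absolute values of Gauss sums -/

section GaussSums

variable {K : Type*} [Field K] [Fintype K] {χ : MulChar K ℂ} {ψ : AddChar K ℂ}

theorem gaussSum_mul_gaussSum_inv (hχ : χ ≠ 1) (hψ : ψ ≠ 1) :
    gaussSum χ ψ * gaussSum χ⁻¹ ψ = χ (-1) * Fintype.card K := by
  rw [← gaussSum_mul_gaussSum_eq_card hχ (AddChar.IsPrimitive.of_ne_one hψ),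
    ← mul_gaussSum_inv_eq_gaussSum χ⁻¹ ψ, MulChar.inv_apply', inv_neg_one]
  ring

theorem norm_gaussSum (hχ : χ ≠ 1) (hψ : ψ ≠ 1) :
    ‖gaussSum χ ψ‖ = √(Fintype.card K) := by
  have h := gaussSum_mul_gaussSum_eq_card hχ (AddChar.IsPrimitive.of_ne_one hψ)
  rw [← star_gaussSum_eq, ← starRingEnd_apply, Complex.mul_conj, Complex.normSq_eq_norm_sq] at h
  rw [← Real.sqrt_sq (norm_nonneg (gaussSum χ ψ))]
  congr 1
  exact_mod_cast h

theorem norm_mulChar_apply (χ : MulChar K ℂ) {a : K} (ha : a ≠ 0) : ‖χ a‖ = 1 := by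
  refine Complex.norm_eq_one_of_pow_eq_one (n := orderOf χ) ?_ χ.orderOf_pos.ne'
  rw [← MulChar.pow_apply' _ χ.orderOf_pos.ne', pow_orderOf_eq_one, MulChar.one_apply ha.isUnit]

end GaussSums

/-! ### The weights of the codewords -/

section Weight

variable {F K L : Type*} [Field F] [Field K] [Field L] [Fintype F] [Fintype K] [Fintype L]
  [DecidableEq F] [DecidableEq L] [Algebra F K] [Algebra F L] [Algebra K L] [IsScalarTower F K L]

/-- The character sum over the defining set in terms of Gauss sums over `K`. -/
theorem sum_definingSet_eq_gaussSum {φ : MulChar K ℂ}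
    (hφ : orderOf φ = (Fintype.card K - 1) / (Fintype.card F - 1))
    {ψ : AddChar F ℂ} (hψ : ψ ≠ 1) {b : L} (hb : b ≠ 0) :
    ((Fintype.card K : ℂ) - 1) * ∑ d ∈ definingSet F K L, ψ (Algebra.trace F L (b * d))
      = -((Fintype.card F : ℂ) ^ (Module.finrank F K - 1) - 1)
        + (-1) ^ (Module.finrank K L - 1) * (((Fintype.card F : ℂ) - 1) / Fintype.card F)
          * Fintype.card K
          * ∑ j ∈ Finset.Icc 1 (orderOf φ - 1), (φ ^ j) (-1)
            * gaussSum (φ ^ j) (traceAddChar K ψ) ^ (Module.finrank K L - 1)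
            * (starRingEnd ℂ) ((φ ^ j) (Algebra.norm K b)) := by
  classical
  have hm : 0 < Module.finrank K L := Module.finrank_pos
  have hψK : traceAddChar K ψ ≠ 1 := traceAddChar_ne_one hψ
  have hF : (Fintype.card F : ℂ) ≠ 0 := Nat.cast_ne_zero.2 Fintype.card_ne_zero
  have hHD (j : ℕ) : ∑ y : L, (φ ^ j) (Algebra.norm K y) * ψ (Algebra.trace F L y)
      = (-1) ^ (Module.finrank K L - 1)
        * gaussSum (φ ^ j) (traceAddChar K ψ) ^ Module.finrank K L := by
    rw [← hasseDavenport_lift (φ ^ j) hψK]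
    refine Finset.sum_congr rfl fun y _ => ?_
    rw [traceAddChar_apply, Algebra.trace_trace]
  have hrange : Finset.range (orderOf φ) = insert 0 (Finset.Icc 1 (orderOf φ - 1)) := by
    have := φ.orderOf_pos
    ext j
    simp only [Finset.mem_range, Finset.mem_insert, Finset.mem_Icc]
    omega
  have hzero : ∑ x : K with Algebra.trace F K x = 0, (1 : MulChar K ℂ) x
      = (Fintype.card F : ℂ) ^ (Module.finrank F K - 1) - 1 := by
    rw [← Nat.cast_pow, ← card_trace_eq_zero (K := K),
      ← Finset.add_sum_erase _ _ (show (0 : K) ∈ _ by simp), MulChar.map_zero, zero_add,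
      Finset.sum_congr rfl fun x hx => MulChar.one_apply (Finset.ne_of_mem_erase hx).isUnit,
      Finset.sum_const, Finset.card_erase_of_mem (by simp), nsmul_one,
      Nat.cast_sub (Finset.card_pos.2 ⟨0, by simp⟩), Nat.cast_one]
  rw [sum_definingSet_eq hφ ψ hb, hrange, Finset.sum_insert (by simp)]
  congr 1
  · rw [hHD, pow_zero, inv_one, hzero, gaussSum_one_left hψK,
      MulChar.one_apply (Algebra.norm_ne_zero_iff.2 hb).isUnit, map_one, ← pow_add,
      Odd.neg_one_pow ⟨Module.finrank K L - 1, by omega⟩]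
    ring
  · rw [Finset.mul_sum]
    refine Finset.sum_congr rfl fun j hj => ?_
    have hj := Finset.mem_Icc.1 hj
    have hne : φ ^ j ≠ 1 := pow_ne_one_of_lt_orderOf (by omega) (by omega)
    have hT := card_mul_sum_trace_eq_zero hψ (inv_ne_one.2 hne) fun u hu => by
      rw [MulChar.inv_apply', ← map_inv₀, MulChar.pow_apply' _ (by omega),
        apply_algebraMap_of_orderOf_eq hφ (inv_ne_zero hu), one_pow]
    have hG := gaussSum_mul_gaussSum_inv hne hψK
    rw [hHD, eq_div_of_mul_eq hF ((mul_comm _ _).trans hT), ← mul_pow_sub_one hm.ne']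
    linear_combination ((starRingEnd ℂ) ((φ ^ j) (Algebra.norm K b))
      * (-1) ^ (Module.finrank K L - 1)
      * gaussSum (φ ^ j) (traceAddChar K ψ) ^ (Module.finrank K L - 1)
      * (((Fintype.card F : ℂ) - 1) / Fintype.card F)) * hG

/-- The Hamming weights of the nonzero codewords in terms of Gauss sums. -/
theorem hammingNorm_codeword_eq {q f k : ℕ} (hq : Fintype.card F = q)
    (hK : Module.finrank F K = f) (hL : Module.finrank F L = k) (hk : 2 ≤ k)
    {φ : MulChar K ℂ} (hφ : orderOf φ = (q ^ f - 1) / (q - 1))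
    {ψ : AddChar F ℂ} (hψ : ψ ≠ 1) {b : L} (hb : b ≠ 0) :
    (hammingNorm (codeword F (definingSet F K L) b) : ℂ) =
      ((q : ℂ) - 1) * (q : ℂ) ^ (k - 2) * ((q : ℂ) ^ f - q) / ((q : ℂ) ^ f - 1)
      - (-1 : ℂ) ^ (k / f - 1) * (q : ℂ) ^ f * ((q : ℂ) - 1) ^ 2
          / ((q : ℂ) ^ 2 * ((q : ℂ) ^ f - 1))
        * ∑ j ∈ Finset.Icc 1 ((q ^ f - 1) / (q - 1) - 1),
            (φ ^ j) (-1) * gaussSum (φ ^ j) (traceAddChar K ψ) ^ (k / f - 1)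
              * (starRingEnd ℂ) ((φ ^ j) (Algebra.norm K b)) := by
  have hcK : Fintype.card K = q ^ f := by
    rw [← hq, ← hK]
    exact Module.card_eq_pow_finrank
  have hcL : Fintype.card L = q ^ k := by
    rw [← hq, ← hL]
    exact Module.card_eq_pow_finrank
  have hf : 0 < f := hK ▸ Module.finrank_pos
  have hm : k / f = Module.finrank K L := by
    rw [← hL, ← hK, ← Module.finrank_mul_finrank F K L, Nat.mul_div_cancel_left _ (hK ▸ hf)]
  have hq1 : 1 < q := hq ▸ Fintype.one_lt_card
  have hq0 : (q : ℂ) ≠ 0 := Nat.cast_ne_zero.2 (by omega)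
  have hQ : (q : ℂ) ^ f - 1 ≠ 0 := by
    have : (q ^ f : ℕ) ≠ 1 := (Nat.one_lt_pow hf.ne' hq1).ne'
    exact sub_ne_zero.2 (by exact_mod_cast this)
  have hW := card_mul_hammingNorm_codeword (K := K) hψ b
  have hS := sum_definingSet_eq_gaussSum (by rw [hφ, hcK, hq]) hψ hb
  have hD := congrArg (Nat.cast (R := ℂ)) (card_definingSet_mul (F := F) (K := K) (L := L))
  rw [hcK, hcL, hq, hK, Nat.cast_mul, Nat.cast_mul, Nat.cast_sub (Nat.one_le_pow _ _ (by omega)),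
    Nat.cast_sub (Nat.one_le_pow _ _ (by omega)), Nat.cast_sub (Nat.one_le_pow _ _ (by omega))] at hD
  rw [hcK, hq, hK, hφ, ← hm] at hS
  rw [hq] at hW
  push_cast at hD hS
  obtain ⟨e, rfl⟩ : ∃ e, f = e + 1 := ⟨f - 1, by omega⟩
  obtain ⟨l, rfl⟩ : ∃ l, k = l + 2 := ⟨k - 2, by omega⟩
  set T := ∑ j ∈ Finset.Icc 1 ((q ^ (e + 1) - 1) / (q - 1) - 1),
            (φ ^ j) (-1) * gaussSum (φ ^ j) (traceAddChar K ψ) ^ ((l + 2) / (e + 1) - 1)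
              * (starRingEnd ℂ) ((φ ^ j) (Algebra.norm K b))
  set S := ∑ d ∈ definingSet F K L, ψ (Algebra.trace F L (b * d))
  set w : ℂ := (hammingNorm (codeword F (definingSet F K L) b) : ℂ)
  set s : ℂ := (-1) ^ ((l + 2) / (e + 1) - 1)
  simp only [Nat.add_sub_cancel] at hD hS ⊢
  have hS' : (q : ℂ) * (((q : ℂ) ^ (e + 1) - 1) * S)
      = -(q * ((q : ℂ) ^ e - 1)) + s * (q - 1) * (q : ℂ) ^ (e + 1) * T := by
    rw [hS]
    field_simp
  have key : (q : ℂ) ^ 2 * ((q : ℂ) ^ (e + 1) - 1) * w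
      = (q - 1) * q ^ l * (q ^ (e + 1) - q) * q ^ 2 - s * q ^ (e + 1) * (q - 1) ^ 2 * T := by
    linear_combination q * ((q : ℂ) ^ (e + 1) - 1) * hW + q * (q - 1) * hD - (q - 1) * hS'
  field_simp
  linear_combination key

/-- The bound on the minimum distance, from the absolute value `√|K|` of a nontrivial Gauss sum
over `K`. -/
theorem le_hammingNorm_codeword {q f k : ℕ} (hq : Fintype.card F = q)
    (hK : Module.finrank F K = f) (hL : Module.finrank F L = k) (hk : 2 ≤ k)
    {ψ : AddChar F ℂ} (hψ : ψ ≠ 1) {b : L} (hb : b ≠ 0) :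
    ((q : ℝ) - 1) * ((q : ℝ) ^ f - q)
        * ((q : ℝ) ^ (k - 2) - (q : ℝ) ^ (((k : ℝ) + f - 4) / 2)) / ((q : ℝ) ^ f - 1)
      ≤ (hammingNorm (codeword F (definingSet F K L) b) : ℝ) := by
  have hcK : Fintype.card K = q ^ f := by
    rw [← hq, ← hK]
    exact Module.card_eq_pow_finrank
  have hf : 0 < f := hK ▸ Module.finrank_pos
  have hkm : k = f * Module.finrank K L := by
    rw [← hL, ← hK, Module.finrank_mul_finrank F K L]
  have hm0 : 0 < Module.finrank K L := Module.finrank_pos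
  have hm : k / f = Module.finrank K L := by
    rw [hkm, Nat.mul_div_cancel_left _ hf]
  have hq1 : 1 < q := hq ▸ Fintype.one_lt_card
  have hq0 : (0 : ℝ) < q := by exact_mod_cast (by omega : 0 < q)
  have hq1' : (0 : ℝ) < (q : ℝ) - 1 := sub_pos.2 (by exact_mod_cast hq1)
  have hQ : (0 : ℝ) < (q : ℝ) ^ f - 1 :=
    sub_pos.2 (one_lt_pow₀ (by exact_mod_cast hq1) hf.ne')
  have hNmul : (q ^ f - 1) / (q - 1) * (q - 1) = q ^ f - 1 :=
    Nat.div_mul_cancel (by simpa using Nat.sub_dvd_pow_sub_pow q 1 f)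
  have hN0 : 0 < (q ^ f - 1) / (q - 1) :=
    Nat.div_pos (Nat.sub_le_sub_right (Nat.le_self_pow hf.ne' q) 1) (by omega)
  obtain ⟨φ, hφ⟩ := MulChar.exists_mulChar_orderOf K (n := (q ^ f - 1) / (q - 1))
    (by rw [hcK]; exact ⟨_, hNmul.symm⟩) (Complex.isPrimitiveRoot_exp _ hN0.ne')
  have hw := hammingNorm_codeword_eq hq hK hL hk hφ hψ hb
  set T := ∑ j ∈ Finset.Icc 1 ((q ^ f - 1) / (q - 1) - 1),
            (φ ^ j) (-1) * gaussSum (φ ^ j) (traceAddChar K ψ) ^ (k / f - 1)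
              * (starRingEnd ℂ) ((φ ^ j) (Algebra.norm K b))
  set w := hammingNorm (codeword F (definingSet F K L) b)
  have hT : ‖T‖ ≤ (((q ^ f - 1) / (q - 1) - 1 : ℕ) : ℝ)
      * (q : ℝ) ^ (((k : ℝ) - f) / 2) := by
    have hterm : ∀ j ∈ Finset.Icc 1 ((q ^ f - 1) / (q - 1) - 1),
        ‖(φ ^ j) (-1) * gaussSum (φ ^ j) (traceAddChar K ψ) ^ (k / f - 1)
          * (starRingEnd ℂ) ((φ ^ j) (Algebra.norm K b))‖ ≤ (q : ℝ) ^ (((k : ℝ) - f) / 2) := by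
      intro j hj
      have hj := Finset.mem_Icc.1 hj
      have hne : φ ^ j ≠ 1 := pow_ne_one_of_lt_orderOf (by omega) (by omega)
      rw [norm_mul, norm_mul, norm_pow, RCLike.norm_conj,
        norm_mulChar_apply _ (neg_ne_zero.2 one_ne_zero),
        norm_mulChar_apply _ (Algebra.norm_ne_zero_iff.2 hb), one_mul, mul_one,
        norm_gaussSum hne (traceAddChar_ne_one hψ), hcK, Nat.cast_pow, Real.sqrt_eq_rpow,
        ← Real.rpow_natCast (q : ℝ) f, ← Real.rpow_mul hq0.le, ← Real.rpow_natCast,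
        ← Real.rpow_mul hq0.le, hm, Nat.cast_sub hm0, hkm]
      refine le_of_eq ?_
      congr 1
      push_cast
      ring
    refine (norm_sum_le_of_le _ hterm).trans_eq ?_
    rw [Finset.sum_const, Nat.card_Icc, Nat.add_sub_cancel, nsmul_eq_mul]
  have hN : (((q ^ f - 1) / (q - 1) - 1 : ℕ) : ℝ) * ((q : ℝ) - 1) = (q : ℝ) ^ f - q := by
    have h := congrArg (Nat.cast (R := ℝ)) hNmul
    rw [Nat.cast_mul, Nat.cast_sub hq1.le, Nat.cast_sub (Nat.one_le_pow _ _ (by omega)),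
      Nat.cast_pow, Nat.cast_one] at h
    rw [Nat.cast_sub hN0, sub_mul, h]
    push_cast
    ring
  have hexp : (q : ℝ) ^ (((k : ℝ) + f - 4) / 2) * q ^ 2
      = q ^ f * (q : ℝ) ^ (((k : ℝ) - f) / 2) := by
    rw [← Real.rpow_natCast (q : ℝ) f, ← Real.rpow_natCast (q : ℝ) 2, ← Real.rpow_add hq0,
      ← Real.rpow_add hq0]
    congr 1
    push_cast
    ring
  -- The main term minus the weight is real; its absolute value is that of the sum over `j`.
  have hdiff : ‖((((q : ℝ) - 1) * (q : ℝ) ^ (k - 2) * ((q : ℝ) ^ f - q)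
        / ((q : ℝ) ^ f - 1) - w : ℝ) : ℂ)‖
      = (q : ℝ) ^ f * ((q : ℝ) - 1) ^ 2 / ((q : ℝ) ^ 2 * ((q : ℝ) ^ f - 1)) * ‖T‖ := by
    have h : ((((q : ℝ) - 1) * (q : ℝ) ^ (k - 2) * ((q : ℝ) ^ f - q)
        / ((q : ℝ) ^ f - 1) - w : ℝ) : ℂ)
        = (-1) ^ (k / f - 1)
          * (((q : ℝ) ^ f * ((q : ℝ) - 1) ^ 2 / ((q : ℝ) ^ 2 * ((q : ℝ) ^ f - 1)) : ℝ) : ℂ) * T := by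
      push_cast
      rw [hw]
      ring
    rw [h, norm_mul, norm_mul, norm_pow, norm_neg, norm_one, one_pow, one_mul, Complex.norm_real,
      Real.norm_of_nonneg (by positivity)]
  rw [Complex.norm_real] at hdiff
  have hle := (le_abs_self _).trans_eq hdiff
  have hbound : (q : ℝ) ^ f * ((q : ℝ) - 1) ^ 2 / ((q : ℝ) ^ 2 * ((q : ℝ) ^ f - 1)) * ‖T‖
      ≤ ((q : ℝ) - 1) * ((q : ℝ) ^ f - q) * (q : ℝ) ^ (((k : ℝ) + f - 4) / 2)
        / ((q : ℝ) ^ f - 1) := by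
    refine (mul_le_mul_of_nonneg_left hT (by positivity)).trans_eq ?_
    rw [← hN]
    field_simp
    linear_combination -(((q ^ f - 1) / (q - 1) - 1 : ℕ) : ℝ) * hexp
  have hsplit : ((q : ℝ) - 1) * ((q : ℝ) ^ f - q)
        * ((q : ℝ) ^ (k - 2) - (q : ℝ) ^ (((k : ℝ) + f - 4) / 2)) / ((q : ℝ) ^ f - 1)
      = ((q : ℝ) - 1) * (q : ℝ) ^ (k - 2) * ((q : ℝ) ^ f - q) / ((q : ℝ) ^ f - 1)
        - ((q : ℝ) - 1) * ((q : ℝ) ^ f - q) * (q : ℝ) ^ (((k : ℝ) + f - 4) / 2)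
          / ((q : ℝ) ^ f - 1) := by
    ring
  rw [hsplit]
  linarith

end Weight

/-! ### The canonical additive character -/

section CanonicalCharacter

variable (p : ℕ) [Fact p.Prime]

theorem canonicalAddChar_ne_one (F : Type*) [Field F] [Finite F] [Algebra (ZMod p) F] :
    canonicalAddChar p F ≠ 1 := by
  have : Module.Finite (ZMod p) F := Module.Finite.of_finite
  obtain ⟨x, hx⟩ := Algebra.trace_surjective (ZMod p) F 1
  refine AddChar.ne_one_iff.2 ⟨x, ?_⟩
  change ZMod.stdAddChar (Algebra.trace (ZMod p) F x) ≠ 1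
  rw [hx, ← AddChar.map_zero_eq_one (ZMod.stdAddChar (N := p))]
  exact fun h => one_ne_zero (ZMod.injective_stdAddChar h)

theorem traceAddChar_canonicalAddChar (F K : Type*) [Field F] [Field K] [Finite K]
    [Algebra F K] [Algebra (ZMod p) F] [Algebra (ZMod p) K] :
    traceAddChar K (canonicalAddChar p F) = canonicalAddChar p K := by
  have : IsScalarTower (ZMod p) F K := .of_algebraMap_eq' (Subsingleton.elim _ _)
  have : Finite F := Finite.of_injective _ (algebraMap F K).injective
  have : Module.Finite (ZMod p) F := Module.Finite.of_finite
  ext x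
  change ZMod.stdAddChar (Algebra.trace (ZMod p) F (Algebra.trace F K x))
    = ZMod.stdAddChar (Algebra.trace (ZMod p) K x)
  rw [Algebra.trace_trace]

end CanonicalCharacter

/-! ### The parameters of the code -/

/-- If all `c_b` with `b ≠ 0` have weight at least `c > 0`, then `b ↦ c_b` is injective, so that the
code has dimension `[L : F]`, and the minimum distance is at least `c`. -/
theorem exists_isLinearCode_linearCode {F L : Type*} [Field F] [Field L] [DecidableEq F]
    [Algebra F L] (D : Finset L) {c : ℝ} (hc : 0 < c)
    (h : ∀ b : L, b ≠ 0 → c ≤ hammingNorm (codeword F D b)) :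
    ∃ d : ℕ, IsLinearCode (linearCode F D) D.card (Module.finrank F L) d ∧ c ≤ d := by
  have hne (b : L) (hb : b ≠ 0) : codeword F D b ≠ 0 := fun h0 => by
    have := h b hb
    rw [h0, hammingNorm_zero, Nat.cast_zero] at this
    exact this.not_gt hc
  have hinj : Function.Injective (codeword F D) :=
    (injective_iff_map_eq_zero _).2 fun b hb => by_contra fun h0 => hne b h0 hb
  set W := {w : ℕ | ∃ x ∈ linearCode F D, ∃ y ∈ linearCode F D, x ≠ y ∧ hammingDist x y = w}
  have hW : W.Nonempty := ⟨_, codeword F D 1, ⟨1, rfl⟩, 0, zero_mem _, hne 1 one_ne_zero, rfl⟩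
  refine ⟨sInf W, ⟨Fintype.card_coe D, LinearMap.finrank_range_of_inj hinj, Nat.sInf_mem hW,
    fun w hw => Nat.sInf_le hw⟩, ?_⟩
  obtain ⟨_, ⟨a, rfl⟩, _, ⟨a', rfl⟩, hne', hd⟩ := Nat.sInf_mem hW
  rw [← hd, hammingDist_eq_hammingNorm, neg_add_eq_sub, ← map_sub]
  exact h _ (sub_ne_zero.2 fun h => hne' (h ▸ rfl))

theorem theorem1 (p q f k : ℕ) [Fact p.Prime]
    (F K L : Type*) [Field F] [Field K] [Field L] [Fintype F] [Fintype K] [Fintype L]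
    [DecidableEq F] [DecidableEq L]
    [Algebra F K] [Algebra F L] [Algebra K L] [IsScalarTower F K L] [Algebra (ZMod p) K]
    (hq : Fintype.card F = q) (hK : Module.finrank F K = f) (hL : Module.finrank F L = k)
    (hf : 1 < f) (hfk : f < k) :
    (∀ φ : MulChar K ℂ, orderOf φ = (q ^ f - 1) / (q - 1) → ∀ b : L, b ≠ 0 →
      (hammingNorm (codeword F (definingSet F K L) b) : ℂ) =
        ((q : ℂ) - 1) * (q : ℂ) ^ (k - 2) * ((q : ℂ) ^ f - q) / ((q : ℂ) ^ f - 1)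
        - (-1 : ℂ) ^ (k / f - 1) * (q : ℂ) ^ f * ((q : ℂ) - 1) ^ 2
            / ((q : ℂ) ^ 2 * ((q : ℂ) ^ f - 1))
          * ∑ j ∈ Finset.Icc 1 ((q ^ f - 1) / (q - 1) - 1),
              (φ ^ j) (-1) * gaussSum (φ ^ j) (canonicalAddChar p K) ^ (k / f - 1)
                * (starRingEnd ℂ) ((φ ^ j) (Algebra.norm K b))) ∧
    ∃ n d : ℕ, IsLinearCode (linearCode F (definingSet F K L)) n k d ∧
      (n : ℝ) = ((q : ℝ) ^ k - 1) * ((q : ℝ) ^ f - q) / ((q : ℝ) * ((q : ℝ) ^ f - 1)) ∧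
      ((q : ℝ) - 1) * ((q : ℝ) ^ f - q)
          * ((q : ℝ) ^ (k - 2) - (q : ℝ) ^ (((k : ℝ) + f - 4) / 2)) / ((q : ℝ) ^ f - 1)
        ≤ (d : ℝ) := by
  have hk : 2 ≤ k := by omega
  have : CharP K p := (Algebra.charP_iff (ZMod p) K p).1 (ZMod.charP p)
  have : CharP F p := (RingHom.charP_iff _ (algebraMap F K).injective p).2 this
  -- With this `ZMod p`-algebra structure, the canonical character of `K` is that of `F` composed
  -- with the trace.
  let := ZMod.algebra F p
  have hψ := canonicalAddChar_ne_one p F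
  refine ⟨fun φ hφ b hb => ?_, ?_⟩
  · rw [← traceAddChar_canonicalAddChar p F K]
    exact hammingNorm_codeword_eq hq hK hL hk hφ hψ hb
  have hq1 : 1 < q := hq ▸ Fintype.one_lt_card
  have hq1' : (1 : ℝ) < q := by exact_mod_cast hq1
  have hQ : (1 : ℝ) < (q : ℝ) ^ f := one_lt_pow₀ hq1' (by omega)
  have hqQ : (q : ℝ) < (q : ℝ) ^ f := lt_self_pow₀ hq1' hf
  have hexp : (q : ℝ) ^ (((k : ℝ) + f - 4) / 2) < (q : ℝ) ^ (k - 2) := by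
    rw [← Real.rpow_natCast, Nat.cast_sub hk]
    refine Real.rpow_lt_rpow_of_exponent_lt hq1' ?_
    have : (f : ℝ) < k := by exact_mod_cast hfk
    push_cast
    linarith
  obtain ⟨d, hd, hle⟩ := exists_isLinearCode_linearCode (F := F) (definingSet F K L)
    (div_pos (mul_pos (mul_pos (sub_pos.2 hq1') (sub_pos.2 hqQ)) (sub_pos.2 hexp)) (sub_pos.2 hQ))
    fun b hb => le_hammingNorm_codeword hq hK hL hk hψ hb
  rw [hL] at hd
  refine ⟨_, d, hd, ?_, hle⟩
  have hD := congrArg (Nat.cast (R := ℝ)) (card_definingSet_mul (F := F) (K := K) (L := L))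
  rw [Module.card_eq_pow_finrank (K := F) (V := K), Module.card_eq_pow_finrank (K := F) (V := L),
    hq, hK, hL, Nat.cast_mul, Nat.cast_mul, Nat.cast_sub (Nat.one_le_pow _ _ (by omega)),
    Nat.cast_sub (Nat.one_le_pow _ _ (by omega)),
    Nat.cast_sub (Nat.one_le_pow _ _ (by omega))] at hD
  push_cast at hD
  have hfe : (q : ℝ) ^ f = q * q ^ (f - 1) := (mul_pow_sub_one (by omega) _).symm
  rw [eq_div_iff (mul_pos (by linarith) (sub_pos.2 hQ)).ne']
  linear_combination q * hD - ((q : ℝ) ^ k - 1) * hfe
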